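/- Let $S$ be the set of all permutations $\pi=\pi_1\pi_2\cdots\pi_n$ of $\{1,\dots,n\}$, $n\ge 0$, in one-line notation. For $\sigma,\tau\in S$ of lengths $k$ and $n$, an \emph{occurrence} of $\sigma$ in $\tau$ as a quasi-consecutive pattern is a choice of positions $i_1<i_2<\cdots<i_k$ such that $\tau_{i_1}\tau_{i_2}\cdots\tau_{i_k}$ is order-isomorphic to $\sigma$ and $i_{j+1}=i_j+1$ for all $2\le j<k$ (so all the entries are adjacent in $\tau$, except possibly the first and the second). The occurrence is \emph{consecutive} if also $i_2=i_1+1$, and it \emph{involves} the entries $\tau_{i_1},\dots,\tau_{i_k}$ of $\tau$. The quasi-consecutive pattern poset is $S$ ordered by $\sigma\le\tau$ if and only if $\sigma$ has an occurrence in $\tau$ as a quasi-consecutive pattern. Let $\mu$ be its Möbius function, that is, $\mu(\sigma,\sigma)=1$ and $\mu(\sigma,\tau)=-\sum_{\sigma\le\rho<\tau}\mu(\sigma,\rho)$ for $\sigma<\tau$, and let the rank of $[\sigma,\tau]$ be the length of its longest chains. \textbf{Theorem.} Suppose that $\sigma$ occurs exactly once in $\tau=a_1a_2\cdots a_n$ as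 a quasi-consecutive pattern; below, "$\sigma$ involves $a_i$" means that this unique occurrence involves $a_i$. Then $\mu(\sigma,\tau)=0$, unless one of the following holds: \begin{itemize} \item $\sigma=\tau$, in which case $\mu(\sigma,\tau)=1$; \item $\tau$ covers $\sigma$, in which case $\mu(\sigma,\tau)=-1$; \item $[\sigma,\tau]$ has rank $2$ and $\sigma$ involves $a_1$ but neither $a_2$ nor $a_n$, in which case $\mu(\sigma,\tau)=1$; \item $[\sigma,\tau]$ has rank $2$ and $\sigma$ involves $a_2$ but neither $a_1$ nor $a_n$, in which case $\mu(\sigma,\tau)=1$; \item $[\sigma,\tau]$ has rank $2$, $\sigma$ involves $a_n$ but neither $a_1$ nor $a_2$, and $a_1$ and $a_2$ are not consecutive integers (i.e. $|a_1-a_2|\ne 1$), in which case $\mu(\sigma,\tau)=1$; \item $[\sigma,\tau]$ has rank $3$, $\sigma$ involves $a_{n-1}$ but none of $a_1$, $a_2$, $a_n$, the occurrence of $\sigma$ in $\tau$ is consecutive, and $\tau$ covers exactly three elements of $[\sigma,\tau]$, in which case $\mu(\sigma,\tau)=-1$. \end{itemize} -/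

import Mathlib

namespace QuasiConsecutive

/-- A finite permutation `π = π₁ π₂ ⋯ πₙ` in one-line notation, of length `n = len`.
Positions and values are counted from `0`, so that `entry i` is `π_{i+1} - 1`. -/
@[ext]
structure Permutation where
  len : ℕ
  entry : Equiv.Perm (Fin len)

instance : DecidableEq Permutation
  | ⟨m, s⟩, ⟨n, t⟩ =>
    if h : m = n then by
      subst h
      exact if h' : s = t then isTrue (by rw [h'])
        else isFalse (fun e => h' (by injection e))
    else isFalse (fun e => h (by injection e))

/-- `f` chooses the positions of a subsequence of `τ`. It is an occurrence of `σ` as a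
quasi-consecutive pattern when the chosen subsequence is order-isomorphic to `σ` and all its
entries are adjacent in `τ`, except at most the first and the second ones. -/
def IsOccurrence (σ τ : Permutation) (f : Fin σ.len ↪o Fin τ.len) : Prop :=
  (∀ i j : Fin σ.len, σ.entry i < σ.entry j ↔ τ.entry (f i) < τ.entry (f j)) ∧
  (∀ i j : Fin σ.len, 1 ≤ (i : ℕ) → (j : ℕ) = i + 1 → (f j : ℕ) = f i + 1)

/-- The chosen subsequence consists of adjacent entries of `τ` only. -/
def IsConsecutive {σ τ : Permutation} (f : Fin σ.len ↪o Fin τ.len) : Prop :=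
  ∀ i j : Fin σ.len, (j : ℕ) = i + 1 → (f j : ℕ) = f i + 1

/-- The chosen subsequence of `τ = a₁ a₂ ⋯ aₙ` involves the entry `a_k` (with `k` counted
from `1`). -/
def Involves {σ τ : Permutation} (f : Fin σ.len ↪o Fin τ.len) (k : ℕ) : Prop :=
  ∃ i : Fin σ.len, (f i : ℕ) + 1 = k

/-- The first two entries of `τ` are consecutive integers (in either order). -/
def FirstTwoConsecutive (τ : Permutation) : Prop :=
  ∃ i j : Fin τ.len, (i : ℕ) = 0 ∧ (j : ℕ) = 1 ∧
    ((τ.entry i : ℕ) + 1 = τ.entry j ∨ (τ.entry j : ℕ) + 1 = τ.entry i)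

/-- The quasi-consecutive pattern containment relation. -/
instance : LE Permutation :=
  ⟨fun σ τ => ∃ f : Fin σ.len ↪o Fin τ.len, IsOccurrence σ τ f⟩

theorem le_def {σ τ : Permutation} :
    σ ≤ τ ↔ ∃ f : Fin σ.len ↪o Fin τ.len, IsOccurrence σ τ f := Iff.rfl

theorem len_le_of_le {σ τ : Permutation} (h : σ ≤ τ) : σ.len ≤ τ.len := by
  obtain ⟨f, -⟩ := h
  simpa using Fintype.card_le_of_embedding f.toEmbedding

theorem le_apply {m n : ℕ} (f : Fin m ↪o Fin n) (i : Fin m) : (i : ℕ) ≤ f i := by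
  obtain ⟨k, hk⟩ := i
  induction k with
  | zero => simp
  | succ k ih =>
    have h1 := ih (by omega)
    have h2 : f ⟨k, by omega⟩ < f ⟨k + 1, hk⟩ := f.strictMono (by simp [Fin.lt_def])
    rw [Fin.lt_def] at h2
    simp only at h1 ⊢
    omega

theorem perm_le_refl (σ : Permutation) : σ ≤ σ :=
  ⟨RelEmbedding.refl _, fun _ _ => Iff.rfl, fun _ _ _ h => h⟩

theorem perm_le_trans {ρ σ τ : Permutation} (h₁ : ρ ≤ σ) (h₂ : σ ≤ τ) : ρ ≤ τ := by
  obtain ⟨f, hf, hf'⟩ := h₁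
  obtain ⟨g, hg, hg'⟩ := h₂
  refine ⟨f.trans g, fun i j => (hf i j).trans (hg _ _), fun i j hi hij => ?_⟩
  exact hg' (f i) (f j) (hi.trans (le_apply f i)) (hf' i j hi hij)

theorem eq_of_le_of_len_eq {σ τ : Permutation} (h : σ ≤ τ) (hl : σ.len = τ.len) : σ = τ := by
  obtain ⟨n, s⟩ := σ
  obtain ⟨m, t⟩ := τ
  obtain ⟨f, hf, -⟩ := h
  simp only at hl f hf
  subst hl
  have hid : ∀ i, f i = i := by
    have hb : Function.Bijective f := Finite.injective_iff_bijective.1 f.injective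
    let e : Fin n ≃o Fin n :=
      { toEquiv := Equiv.ofBijective f hb, map_rel_iff' := f.map_rel_iff' }
    intro i
    have : e = OrderIso.refl _ := Subsingleton.elim _ _
    exact congrArg (fun e : Fin n ≃o Fin n => e i) this
  simp only [hid] at hf
  have hst : s = t := by
    have hmono : StrictMono (fun i => t (s.symm i)) := by
      intro i j hij
      have := (hf (s.symm i) (s.symm j)).1 (by simpa using hij)
      simpa using this
    have hb : Function.Bijective (fun i => t (s.symm i)) := (s.symm.trans t).bijective
    let e : Fin n ≃o Fin n :=
      { toEquiv := s.symm.trans t, map_rel_iff' := fun {a b} => hmono.le_iff_le (a := a) (b := b) }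
    have he : e = OrderIso.refl _ := Subsingleton.elim _ _
    ext i
    have h1 : e (s i) = s i := congrArg (fun e : Fin n ≃o Fin n => e (s i)) he
    have h2 : e (s i) = t i := by
      change t (s.symm (s i)) = t i
      simp
    rw [← h2, h1]
  rw [hst]

/-- The quasi-consecutive pattern poset. -/
instance : PartialOrder Permutation where
  le_refl := perm_le_refl
  le_trans _ _ _ := perm_le_trans
  le_antisymm _ _ h₁ h₂ :=
    eq_of_le_of_len_eq h₁ (le_antisymm (len_le_of_le h₁) (len_le_of_le h₂))

theorem finite_Icc (σ τ : Permutation) : (Set.Icc σ τ).Finite := by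
  let F : (Σ n : Fin (τ.len + 1), Equiv.Perm (Fin n)) → Permutation := fun x => ⟨x.1, x.2⟩
  refine (Set.finite_range F).subset ?_
  rintro ⟨n, s⟩ ⟨-, h⟩
  have hn : n ≤ τ.len := len_le_of_le h
  exact ⟨⟨⟨n, by omega⟩, s⟩, rfl⟩

noncomputable instance : LocallyFiniteOrder Permutation :=
  LocallyFiniteOrder.ofFiniteIcc finite_Icc

/-- The rank of the interval `[σ, τ]`: the maximal length of its chains. -/
noncomputable def intervalRank (σ τ : Permutation) : WithBot ℕ∞ :=
  Order.krullDim (Set.Icc σ τ)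

/-- Removing the entry in position `p` and renaming the remaining ones. -/
theorem exists_delete {n : ℕ} (t : Equiv.Perm (Fin (n + 1))) (p : Fin (n + 1)) :
    ∃ r : Equiv.Perm (Fin n), ∀ i j, r i < r j ↔ t (p.succAbove i) < t (p.succAbove j) := by
  have h : ∀ i, ∃ y, (t p).succAbove y = t (p.succAbove i) := fun i =>
    Fin.exists_succAbove_eq (fun e => Fin.succAbove_ne p i (t.injective e))
  choose y hy using h
  have hinj : Function.Injective y := by
    intro i j hij
    have := (hy i).symm.trans ((congrArg _ hij).trans (hy j))
    exact Fin.succAbove_right_injective (t.injective this)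
  refine ⟨Equiv.ofBijective y (Finite.injective_iff_bijective.1 hinj), fun i j => ?_⟩
  rw [← hy, ← hy]
  exact (Fin.strictMono_succAbove (t p)).lt_iff_lt.symm

theorem exists_intermediate {σ τ : Permutation} (h : σ ≤ τ) (hl : σ.len < τ.len) :
    ∃ ρ : Permutation, τ.len = ρ.len + 1 ∧ σ ≤ ρ ∧ ρ ≤ τ := by
  obtain ⟨m, s⟩ := σ
  obtain ⟨n', t⟩ := τ
  obtain ⟨f, hf, hf'⟩ := h
  simp only at hl f hf hf'
  obtain ⟨n, rfl⟩ : ∃ n, n' = n + 1 := ⟨n' - 1, by omega⟩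
  -- one of the first, second, last positions is not used
  obtain ⟨p, hp, hpf⟩ : ∃ p : Fin (n + 1), ((p : ℕ) = 0 ∨ (p : ℕ) = 1 ∨ (p : ℕ) = n) ∧
      ∀ i, f i ≠ p := by
    by_contra! hcon
    obtain ⟨i, hi⟩ := hcon 0 (by simp)
    obtain ⟨j, hj⟩ := hcon (Fin.last n) (by simp)
    by_cases hn : n = 0
    · subst hn
      have := i.2
      omega
    obtain ⟨k, hk⟩ := hcon ⟨1, by omega⟩ (by simp)
    have key : ∀ d (hd : d + 1 < m), (f ⟨d + 1, hd⟩ : ℕ) = d + 1 := by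
      have hk1 := le_apply f k
      rw [hk] at hk1
      simp only at hk1
      have hik : i < k := f.lt_iff_lt.1 (by rw [hi, hk]; simp [Fin.lt_def])
      have hkv : (k : ℕ) = 1 := by
        rw [Fin.lt_def] at hik
        omega
      intro d
      induction d with
      | zero =>
        intro hd
        have : (⟨0 + 1, hd⟩ : Fin m) = k := Fin.ext (by simp [hkv])
        rw [this, hk]
      | succ d ih =>
        intro hd
        have := hf' ⟨d + 1, by omega⟩ ⟨d + 1 + 1, hd⟩ (by simp) rfl
        rw [this, ih]
    have hj2 := j.2
    have hjv : (f j : ℕ) = n := by rw [hj]; simp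
    have hij : i < j := f.lt_iff_lt.1 (by rw [hi, hj, Fin.lt_def]; simp; omega)
    rw [Fin.lt_def] at hij
    have := key (j - 1) (by omega)
    have hjj : (⟨(j : ℕ) - 1 + 1, by omega⟩ : Fin m) = j := Fin.ext (by simp; omega)
    rw [hjj] at this
    omega
  obtain ⟨r, hr⟩ := exists_delete t p
  have hg : ∀ i, ∃ z, p.succAbove z = f i := fun i => Fin.exists_succAbove_eq (hpf i)
  choose g hg using hg
  have hval : ∀ z : Fin n, (p.succAbove z : ℕ) = if (z : ℕ) < p then (z : ℕ) else z + 1 := by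
    intro z
    by_cases hz : (z : ℕ) < p
    · rw [Fin.succAbove_of_castSucc_lt _ _ (by simpa [Fin.lt_def] using hz)]
      simp [hz]
    · rw [Fin.succAbove_of_le_castSucc _ _ (by simpa [Fin.le_def] using hz)]
      simp [hz]
  refine ⟨⟨n, r⟩, rfl, ?_, ?_⟩
  · refine ⟨OrderEmbedding.ofMapLEIff g fun i j => ?_, fun i j => ?_, fun i j hi hij => ?_⟩
    · rw [← (Fin.strictMono_succAbove p).le_iff_le, hg, hg, f.le_iff_le]
    · simp only [OrderEmbedding.coe_ofMapLEIff]
      rw [hf, hr, hg, hg]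
    · simp only [OrderEmbedding.coe_ofMapLEIff]
      have h1 := hf' i j hi hij
      have h2 := le_apply f i
      have h3 := hpf i
      have h4 := hval (g i)
      have h5 := hval (g j)
      rw [hg] at h4 h5
      have h6 : (f i : ℕ) ≠ p := fun e => h3 (Fin.ext e)
      have h7 := (g i).2
      have h8 := (g j).2
      split_ifs at h4 h5 <;> omega
  · refine ⟨p.succAboveOrderEmb, fun i j => hr i j, fun i j hi hij => ?_⟩
    have h4 := hval i
    have h5 := hval j
    have h7 := j.2
    simp only [Fin.succAboveOrderEmb_apply]
    simp only at hij h7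
    split_ifs at h4 h5 <;> omega

/-- The order is the reflexive and transitive closure of the relation `ρ ≺ π` which holds when
`ρ` is one shorter than `π` and occurs in `π` as a quasi-consecutive pattern. -/
theorem le_iff_reflTransGen {σ τ : Permutation} :
    σ ≤ τ ↔ Relation.ReflTransGen (fun ρ π : Permutation =>
      π.len = ρ.len + 1 ∧ ∃ f : Fin ρ.len ↪o Fin π.len, IsOccurrence ρ π f) σ τ := by
  constructor
  · intro h
    induction hd : τ.len - σ.len generalizing τ with
    | zero =>
      rw [eq_of_le_of_len_eq h (le_antisymm (len_le_of_le h) (by omega))]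
    | succ d ih =>
      obtain ⟨ρ, hρ, h1, h2⟩ := exists_intermediate h (by omega)
      exact (ih h1 (by omega)).tail ⟨hρ, h2⟩
  · intro h
    induction h with
    | refl => exact le_rfl
    | tail _ h ih => exact ih.trans h.2

end QuasiConsecutive

open QuasiConsecutive

/-!
An occurrence of a permutation of length at least two in `τ` is a window: a first position `i`
followed by a block of adjacent positions starting at some `a > i` (`OccursAt`). Suppose that the
only occurrence of `σ` in `τ` has window `(i, a)`. Each element of `[σ, τ]` may occur several times
in `τ`, but `σ` sits at a fixed place in it, and each of its windows in `τ` puts `σ` at `(i, a)`; so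
these windows share their block and differ only in the first position
(`UniqueWindow.eq_of_occursAt`).

Let `c` be `τ` without its last entry. For a window `x` of `τ` that reaches the last entry, the
elements of `[σ, x]` below `c` form the interval `[σ, x']`, where `x'` is `x` without its last entry.
As `μ(σ, ·)` sums to `0` over an interval with more than one element, its sum over the elements of
`[σ, x]` not below `c` is `[σ = x] - [σ = x']` (`UniqueWindow.sum_mu_notBelow`).

This is applied to `τ`, to `c₁` and `c₂` (`τ` without its first, respectively second, entry) and to
`d` (`τ` without both). Every element of `[σ, τ)` is below `c`, `c₁` or `c₂`. The meet of `c₁` and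
`c₂` need not exist, but an element below both that is not below `c` is below `d`, unless `c₁ = c₂`:
otherwise its first entry can be both `τ₁` and `τ₂` but none of the later ones. Then no entry of its
block has a value between `τ₁` and `τ₂`, and neither has an entry before the block, since that could
serve as first entry, too; hence `c₁ = c₂` (`UniqueWindow.le_delete_first_two`).
Inclusion–exclusion then expresses `μ(σ, τ)` through the window `(i, a)` alone (`UniqueWindow.mu_eq`). It remains to translate:
`[σ, τ]` has rank `τ.len - σ.len`, and `c₁ = c₂` exactly when `τ₁` and `τ₂` are consecutive integers.
The case of `σ` of length at most one, where occurrences do not determine windows, is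
elementary.
-/

namespace QuasiConsecutive

/-! ### Windows of a permutation -/

/-- The one-line notation of `τ` as a function on `ℕ`, equal to `0` beyond the length of `τ`. -/
def Permutation.val (τ : Permutation) (j : ℕ) : ℕ :=
  if h : j < τ.len then τ.entry ⟨j, h⟩ else 0

/-- The `j`-th position of the window starting at position `i` and continuing with the
positions `a, a + 1, a + 2, …`. -/
def windowPos (i a j : ℕ) : ℕ := if j = 0 then i else a + (j - 1)

/-- `ρ` occurs in `τ` as a quasi-consecutive pattern at the window of positions
`i < a < a + 1 < ⋯ < a + ρ.len - 2`. For `ρ` of length at least two, such pairs `(i, a)` are the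
same thing as occurrences. -/
structure OccursAt (ρ τ : Permutation) (i a : ℕ) : Prop where
  lt : i < a
  end_le : a + ρ.len ≤ τ.len + 1
  val_lt_iff : ∀ j k, j < ρ.len → k < ρ.len →
    (ρ.val j < ρ.val k ↔ τ.val (windowPos i a j) < τ.val (windowPos i a k))

theorem Permutation.val_of_lt (τ : Permutation) {j : ℕ} (h : j < τ.len) :
    τ.val j = τ.entry ⟨j, h⟩ := dif_pos h

theorem Permutation.val_injective (τ : Permutation) {j k : ℕ} (hj : j < τ.len)
    (hk : k < τ.len) (h : τ.val j = τ.val k) : j = k := by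
  rw [τ.val_of_lt hj, τ.val_of_lt hk] at h
  simpa using τ.entry.injective (Fin.ext h)

theorem windowPos_lt {i a j m n : ℕ} (h : i < a) (h' : a + m ≤ n + 1) (hj : j < m) :
    windowPos i a j < n := by
  unfold windowPos; split_ifs <;> omega

theorem windowPos_strictMono {i a j k : ℕ} (h : i < a) (hjk : j < k) :
    windowPos i a j < windowPos i a k := by
  unfold windowPos; split_ifs <;> omega

theorem OccursAt.refl (τ : Permutation) : OccursAt τ τ 0 1 := by
  have h : ∀ j, windowPos 0 1 j = j := fun j => by unfold windowPos; split_ifs <;> omega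
  exact ⟨by omega, by omega, fun j k _ _ => by simp only [h]⟩

theorem OccursAt.exists_isOccurrence {ρ τ : Permutation} {i a : ℕ} (h : OccursAt ρ τ i a) :
    ∃ g : Fin ρ.len ↪o Fin τ.len, IsOccurrence ρ τ g ∧ ∀ j, (g j : ℕ) = windowPos i a j := by
  refine ⟨OrderEmbedding.ofStrictMono
    (fun j => ⟨windowPos i a j, windowPos_lt h.lt h.end_le j.2⟩)
    (fun j k hjk => windowPos_strictMono h.lt hjk), ⟨fun j k => ?_, fun j k hj hjk => ?_⟩,
    fun j => rfl⟩
  · have := h.val_lt_iff j k j.2 k.2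
    rw [ρ.val_of_lt j.2, ρ.val_of_lt k.2, τ.val_of_lt (windowPos_lt h.lt h.end_le j.2),
      τ.val_of_lt (windowPos_lt h.lt h.end_le k.2)] at this
    exact this
  · simp only [OrderEmbedding.coe_ofStrictMono, windowPos]
    split_ifs <;> omega

theorem OccursAt.le {ρ τ : Permutation} {i a : ℕ} (h : OccursAt ρ τ i a) : ρ ≤ τ :=
  let ⟨g, hg, _⟩ := h.exists_isOccurrence
  ⟨g, hg⟩

theorem exists_occursAt_of_isOccurrence {ρ τ : Permutation} {g : Fin ρ.len ↪o Fin τ.len}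
    (hg : IsOccurrence ρ τ g) (hρ : 2 ≤ ρ.len) :
    ∃ i a, OccursAt ρ τ i a ∧ ∀ j, (g j : ℕ) = windowPos i a j := by
  have hpos : ∀ j (hj : j < ρ.len),
      (g ⟨j, hj⟩ : ℕ) = windowPos (g ⟨0, by omega⟩) (g ⟨1, by omega⟩) j := by
    intro j
    induction j with
    | zero => intro; rfl
    | succ j ih =>
      intro hj
      rcases Nat.eq_zero_or_pos j with rfl | h0
      · rfl
      · rw [hg.2 ⟨j, by omega⟩ ⟨j + 1, hj⟩ h0 rfl, ih (by omega)]
        unfold windowPos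
        split_ifs <;> first | contradiction | omega
  refine ⟨g ⟨0, by omega⟩, g ⟨1, by omega⟩, ⟨?_, ?_, fun j k hj hk => ?_⟩, fun j => hpos j j.2⟩
  · exact g.strictMono (by simp [Fin.lt_def])
  · have h1 := hpos (ρ.len - 1) (by omega)
    have h2 := (g ⟨ρ.len - 1, by omega⟩).2
    unfold windowPos at h1
    split_ifs at h1 <;> omega
  · rw [← hpos j hj, ← hpos k hk, ρ.val_of_lt hj, ρ.val_of_lt hk, τ.val_of_lt (Fin.is_lt _),
      τ.val_of_lt (Fin.is_lt _)]
    exact hg.1 _ _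

theorem exists_occursAt_of_le {ρ τ : Permutation} (h : ρ ≤ τ) (hρ : 2 ≤ ρ.len) :
    ∃ i a, OccursAt ρ τ i a := by
  obtain ⟨g, hg⟩ := h
  obtain ⟨i, a, h, -⟩ := exists_occursAt_of_isOccurrence hg hρ
  exact ⟨i, a, h⟩

/-- Every window of `τ` is the window of an occurrence of some permutation. -/
theorem exists_occursAt (τ : Permutation) {i a m : ℕ} (h : i < a) (h' : a + m ≤ τ.len + 1) :
    ∃ ρ : Permutation, ρ.len = m ∧ OccursAt ρ τ i a := by
  let v : Fin m → ℕ := fun j => τ.val (windowPos i a j)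
  have hv : Function.Injective v := fun j k hjk => by
    have := τ.val_injective (windowPos_lt h h' j.2) (windowPos_lt h h' k.2) hjk
    rcases lt_trichotomy j k with hlt | heq | hgt
    · exact absurd this (windowPos_strictMono h hlt).ne
    · exact heq
    · exact absurd this (windowPos_strictMono h hgt).ne'
  -- the entries of the pattern are the ranks of the values in the window
  let r : Fin m → ℕ := fun j => (Finset.univ.filter fun k => v k < v j).card
  have hr : ∀ j k, v j < v k → r j < r k := fun j k hjk => by
    refine Finset.card_lt_card (Finset.ssubset_iff_of_subset ?_ |>.2 ⟨j, ?_⟩)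
    · intro l hl
      simp only [Finset.mem_filter, Finset.mem_univ, true_and] at hl ⊢
      omega
    · simp [hjk]
  have hr' : ∀ j k, v j < v k ↔ r j < r k := fun j k => by
    refine ⟨hr j k, fun hlt => ?_⟩
    by_contra hcon
    rcases (not_lt.1 hcon).lt_or_eq with h1 | h1
    · exact absurd (hr _ _ h1) (by omega)
    · rw [hv h1] at hlt; omega
  have hrm : ∀ j, r j < m := fun j => by
    have : r j < (Finset.univ : Finset (Fin m)).card :=
      Finset.card_lt_card (Finset.ssubset_iff_of_subset (Finset.subset_univ _) |>.2 ⟨j, by simp⟩)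
    simpa using this
  have hinj : Function.Injective fun j => (⟨r j, hrm j⟩ : Fin m) := fun j k hjk => by
    have hjk : r j = r k := by simpa using hjk
    rcases lt_trichotomy (v j) (v k) with h1 | h1 | h1
    · exact absurd (hr _ _ h1) (by omega)
    · exact hv h1
    · exact absurd (hr _ _ h1) (by omega)
  refine ⟨⟨m, Equiv.ofBijective _ (Finite.injective_iff_bijective.1 hinj)⟩, rfl, h, h',
    fun j k hj hk => ?_⟩
  rw [Permutation.val_of_lt _ hj, Permutation.val_of_lt _ hk]
  exact (hr' ⟨j, hj⟩ ⟨k, hk⟩).symm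

theorem OccursAt.trans {π ρ τ : Permutation} {i a j c : ℕ} (hπ : OccursAt π ρ j c)
    (hρ : OccursAt ρ τ i a) : OccursAt π τ (windowPos i a j) (a + (c - 1)) := by
  have h1 := hπ.lt
  have h2 := hπ.end_le
  have h3 := hρ.lt
  have h4 := hρ.end_le
  refine ⟨by unfold windowPos; split_ifs <;> omega, by omega, fun s t hs ht => ?_⟩
  have hw : ∀ s, windowPos (windowPos i a j) (a + (c - 1)) s =
      windowPos i a (windowPos j c s) := by
    intro s; unfold windowPos; split_ifs <;> omega
  rw [hw, hw, hπ.val_lt_iff s t hs ht, hρ.val_lt_iff]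
  all_goals exact windowPos_lt h1 h2 ‹_›

/-- An occurrence of `π` in `τ` whose window is contained in that of an occurrence of `ρ` comes
from an occurrence of `π` in `ρ`. -/
theorem OccursAt.le_of_window_subset {π ρ τ : Permutation} {i a i' a' : ℕ}
    (hπ : OccursAt π τ i' a') (hρ : OccursAt ρ τ i a) (ha : a ≤ a') (hi : i' = i ∨ a ≤ i')
    (he : a' + π.len ≤ a + ρ.len) : π ≤ ρ := by
  have h1 := hπ.lt
  have h3 := hρ.lt
  have hw : ∀ s, windowPos i a (windowPos (if i' = i then 0 else i' - a + 1) (a' - a + 1) s) =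
      windowPos i' a' s := by
    intro s; unfold windowPos; split_ifs <;> first | contradiction | omega
  have hlt : (if i' = i then 0 else i' - a + 1) < a' - a + 1 := by split_ifs <;> omega
  have hle : a' - a + 1 + π.len ≤ ρ.len + 1 := by omega
  refine OccursAt.le (i := if i' = i then 0 else i' - a + 1) (a := a' - a + 1)
    ⟨hlt, hle, fun s t hs ht => ?_⟩
  rw [hπ.val_lt_iff s t hs ht, hρ.val_lt_iff _ _ (windowPos_lt hlt hle hs)
    (windowPos_lt hlt hle ht), hw, hw]

theorem OccursAt.eq_of_len_eq {π ρ τ : Permutation} {i a : ℕ} (hπ : OccursAt π τ i a)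
    (hρ : OccursAt ρ τ i a) (h : π.len = ρ.len) : π = ρ :=
  eq_of_le_of_len_eq (hπ.le_of_window_subset hρ le_rfl (Or.inl rfl) (by omega)) h

/-- If the first entry of the window may be taken at `i` or at `i'`, then also at any position `p`
before the block whose value lies between those at `i` and `i'`. -/
theorem OccursAt.of_between {ρ τ : Permutation} {i i' p a : ℕ} (h : OccursAt ρ τ i a)
    (h' : OccursAt ρ τ i' a) (hp : p < a) (h1 : τ.val i < τ.val p) (h2 : τ.val p < τ.val i') :
    OccursAt ρ τ p a := by
  refine ⟨hp, h.end_le, fun j k hj hk => ?_⟩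
  have e1 := h.val_lt_iff j k hj hk
  have e2 := h'.val_lt_iff j k hj hk
  unfold windowPos at e1 e2 ⊢
  split_ifs at e1 e2 ⊢ <;> omega

/-- Two entries which compare alike with the rest of the window may replace each other as the
first entry of the window. -/
theorem OccursAt.of_val_lt_iff {ρ τ : Permutation} {i i' a : ℕ} (h : OccursAt ρ τ i a)
    (hi : i' < a) (hv : ∀ p, a ≤ p → p < τ.len → (τ.val i < τ.val p ↔ τ.val i' < τ.val p)) :
    OccursAt ρ τ i' a := by
  refine ⟨hi, h.end_le, fun j k hj hk => ?_⟩
  have hle := h.end_le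
  have hlt := h.lt
  have key : ∀ p, a ≤ p → p < τ.len → (τ.val i < τ.val p ↔ τ.val i' < τ.val p) ∧
      (τ.val p < τ.val i ↔ τ.val p < τ.val i') := fun p hp hp' => by
    have h1 : τ.val i ≠ τ.val p := fun e =>
      absurd (τ.val_injective (by omega) hp' e) (by omega)
    have h2 : τ.val i' ≠ τ.val p := fun e =>
      absurd (τ.val_injective (by omega) hp' e) (by omega)
    have := hv p hp hp'
    omega
  have e1 := h.val_lt_iff j k hj hk
  have k1 := fun h0 => key (a + (j - 1)) (by omega) (h0 : a + (j - 1) < τ.len)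
  have k2 := fun h0 => key (a + (k - 1)) (by omega) (h0 : a + (k - 1) < τ.len)
  unfold windowPos at e1 ⊢
  split_ifs at e1 ⊢ with hj0 hk0 hk0
  · omega
  · rw [e1, (k2 (by omega)).1]
  · rw [e1, (k1 (by omega)).2]
  · exact e1

theorem OccursAt.val_lt_iff_val_lt {ρ τ : Permutation} {i i' a p : ℕ} (h : OccursAt ρ τ i a)
    (h' : OccursAt ρ τ i' a) (hp : a ≤ p) (hp' : p + 1 < a + ρ.len) :
    τ.val i < τ.val p ↔ τ.val i' < τ.val p := by
  have e1 := h.val_lt_iff 0 (p - a + 1) (by omega) (by omega)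
  have e2 := h'.val_lt_iff 0 (p - a + 1) (by omega) (by omega)
  have hw : a + (p - a) = p := by omega
  simp only [windowPos, if_true, Nat.add_eq_zero_iff, one_ne_zero, and_false, if_false,
    Nat.add_sub_cancel, hw] at e1 e2
  rw [← e1, e2]

/-- If the first entry of a final window may be taken to be the first or the second entry of `τ`,
but no later one, then deleting the first or the second entry of `τ` gives the same pattern: no
later entry has a value between the first two, in the block because both compare alike with it,
before the block because of `OccursAt.of_between`. -/
theorem OccursAt.delete_first_two {ρ τ x : Permutation} {a : ℕ} (h0 : OccursAt ρ τ 0 a)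
    (h1 : OccursAt ρ τ 1 a) (hend : a + ρ.len = τ.len + 1)
    (hrep : ∀ p, 2 ≤ p → ¬ OccursAt ρ τ p a) (hx : OccursAt x τ 1 2) : OccursAt x τ 0 2 := by
  refine hx.of_val_lt_iff (by omega) fun p hp hp' => ?_
  rcases lt_or_ge p a with hpa | hpa
  · have hne : ∀ q, q < 2 → τ.val q ≠ τ.val p := fun q hq e =>
      absurd (τ.val_injective (by omega) hp' e) (by omega)
    have b1 := hne 0 (by omega)
    have b2 := hne 1 (by omega)
    have b3 := fun u v => hrep p hp (h0.of_between h1 hpa u v)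
    have b4 := fun u v => hrep p hp (h1.of_between h0 hpa u v)
    constructor
    · intro h
      by_contra hcon
      exact b4 h (by omega)
    · intro h
      by_contra hcon
      exact b3 h (by omega)
  · exact h1.val_lt_iff_val_lt h0 hpa (by omega)

/-- Deleting the first or the second entry gives the same pattern exactly when these entries are
consecutive integers. -/
theorem delete_first_eq_delete_second_iff {τ x y : Permutation} (hx : OccursAt x τ 1 2)
    (hy : OccursAt y τ 0 2) (hxl : x.len + 1 = τ.len) (hyl : y.len + 1 = τ.len)
    (hτ : 2 ≤ τ.len) : x = y ↔ FirstTwoConsecutive τ := by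
  have v0 := τ.val_of_lt (j := 0) (by omega)
  have v1 := τ.val_of_lt (j := 1) (by omega)
  have hne : τ.val 0 ≠ τ.val 1 := fun e =>
    absurd (τ.val_injective (by omega) (by omega) e) (by omega)
  have hlt : ∀ q, q < 2 → τ.val q < τ.len := fun q hq => by
    rw [τ.val_of_lt (by omega)]; exact Fin.is_lt _
  constructor
  · rintro rfl
    refine ⟨⟨0, by omega⟩, ⟨1, by omega⟩, rfl, rfl, ?_⟩
    rw [← v0, ← v1]
    -- otherwise the value following the smaller of the two lies strictly between them, and its
    -- position in the block compares differently with the two possible first entries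
    have key : ∀ q q', q < 2 → q' < 2 → τ.val q < τ.val q' →
        OccursAt x τ q 2 → OccursAt x τ q' 2 → τ.val q + 1 = τ.val q' := by
      intro q q' hq hq' hqq h h'
      by_contra hcon
      have h3 := hlt q' hq'
      obtain ⟨⟨p, hp⟩, hp'⟩ := τ.entry.surjective ⟨τ.val q + 1, by omega⟩
      have hpv : τ.val p = τ.val q + 1 := by rw [τ.val_of_lt hp, hp']
      have hp2 : 2 ≤ p := by
        by_contra hp2
        have : p = q ∨ p = q' := by
          have : q ≠ q' := by rintro rfl; omega
          omega
        rcases this with rfl | rfl <;> omega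
      have := h.val_lt_iff_val_lt h' hp2 (by omega)
      omega
    rcases hne.lt_or_gt with h | h
    · exact Or.inl (key 0 1 (by omega) (by omega) h hy hx)
    · exact Or.inr (key 1 0 (by omega) (by omega) h hx hy)
  · rintro ⟨i, j, hi, hj, hij⟩
    rw [show i = ⟨0, by omega⟩ from Fin.ext hi, show j = ⟨1, by omega⟩ from Fin.ext hj,
      ← v0, ← v1] at hij
    refine (hx.of_val_lt_iff (i' := 0) (by omega) fun p hp hp' => ?_).eq_of_len_eq hy (by omega)
    have b1 : τ.val 0 ≠ τ.val p := fun e =>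
      absurd (τ.val_injective (by omega) hp' e) (by omega)
    have b2 : τ.val 1 ≠ τ.val p := fun e =>
      absurd (τ.val_injective (by omega) hp' e) (by omega)
    omega

/-! ### The interval below a permutation with a unique occurrence -/

/-- `σ` occurs in `τ` at most at one window. -/
def UniqueWindow (σ τ : Permutation) : Prop :=
  ∀ i a i' a', OccursAt σ τ i a → OccursAt σ τ i' a' → i = i' ∧ a = a'

/-- Elements `ρ` of `[σ, τ]` may occur several times in `τ`, but the windows differ only in their
first position, because each of them takes a given occurrence of `σ` in `ρ` to the only one
in `τ`. -/
theorem UniqueWindow.eq_of_occursAt {σ τ ρ : Permutation} (hu : UniqueWindow σ τ)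
    (hk : 2 ≤ σ.len) (hσρ : σ ≤ ρ) {i a i' a' : ℕ} (h : OccursAt ρ τ i a)
    (h' : OccursAt ρ τ i' a') : a = a' := by
  obtain ⟨j, c, hc⟩ := exists_occursAt_of_le hσρ hk
  have := (hu _ _ _ _ (hc.trans h) (hc.trans h')).2
  omega

theorem UniqueWindow.eq_iff {σ τ x : Permutation} (hu : UniqueWindow σ τ) {i a p q : ℕ}
    (hσ : OccursAt σ τ i a) (hx : OccursAt x τ p q) :
    σ = x ↔ i = p ∧ a = q ∧ σ.len = x.len := by
  constructor
  · rintro rfl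
    obtain ⟨rfl, rfl⟩ := hu _ _ _ _ hσ hx
    exact ⟨rfl, rfl, rfl⟩
  · rintro ⟨rfl, rfl, hl⟩
    exact hσ.eq_of_len_eq hx hl

theorem exists_occursAt_of_le_of_occursAt {ρ x τ : Permutation} {p q : ℕ}
    (h : ρ ≤ x) (hρ : 2 ≤ ρ.len) (hx : OccursAt x τ p q) :
    ∃ i a, OccursAt ρ τ i a ∧ q ≤ a ∧ (i = p ∨ q ≤ i) ∧ a + ρ.len ≤ q + x.len := by
  obtain ⟨j, c, hc⟩ := exists_occursAt_of_le h hρ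
  have h1 := hc.lt
  have h2 := hc.end_le
  refine ⟨_, _, hc.trans hx, by omega, ?_, by omega⟩
  unfold windowPos
  split_ifs <;> omega

/-- Above `σ`, deleting the last entry of a final window `x` of `τ` gives the meet of `x` and the
permutation `c` obtained by deleting the last entry of `τ`. -/
theorem UniqueWindow.le_and_le_iff {σ τ ρ x x' c : Permutation} (hu : UniqueWindow σ τ)
    (hk : 2 ≤ σ.len) (hσρ : σ ≤ ρ) {p q : ℕ} (hx : OccursAt x τ p q)
    (hx' : OccursAt x' τ p q) (hl : x'.len + 1 = x.len) (hend : q + x.len = τ.len + 1)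
    (hc : OccursAt c τ 0 1) (hcl : c.len + 1 = τ.len) : ρ ≤ x ∧ ρ ≤ c ↔ ρ ≤ x' := by
  have hlt := hx.lt
  constructor
  · rintro ⟨h1, h2⟩
    have hρ := hk.trans (len_le_of_le hσρ)
    obtain ⟨i, a, h, ha, hi, he⟩ := exists_occursAt_of_le_of_occursAt h1 hρ hx
    obtain ⟨i', a', h', ha', hi', he'⟩ := exists_occursAt_of_le_of_occursAt h2 hρ hc
    obtain rfl := hu.eq_of_occursAt hk hσρ h h'
    exact h.le_of_window_subset hx' ha hi (by omega)
  · intro h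
    exact ⟨h.trans (hx'.le_of_window_subset hx le_rfl (Or.inl rfl) (by omega)),
      h.trans (hx'.le_of_window_subset hc (by omega) (by omega) (by omega))⟩

open scoped Classical in
/-- The part of the interval `[σ, x]` that is not below `c`. -/
noncomputable def notBelow (c σ x : Permutation) : Finset Permutation :=
  (Finset.Icc σ x).filter fun ρ => ¬ ρ ≤ c

theorem mem_notBelow {c σ x ρ : Permutation} :
    ρ ∈ notBelow c σ x ↔ σ ≤ ρ ∧ ρ ≤ x ∧ ¬ ρ ≤ c := by
  classical
  simp only [notBelow, Finset.mem_filter, Finset.mem_Icc, and_assoc]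

/-- `1` if a window of `σ` in `τ` with second position `a` reaches the last entry of `τ`, `-1` if
it stops one entry earlier, and `0` otherwise. -/
def endSign (σ τ : Permutation) (a : ℕ) : ℤ :=
  if a + σ.len = τ.len + 1 then 1 else if a + σ.len = τ.len then -1 else 0

/-- The Möbius function summed over the part of `[σ, x]` that is not below `c`, where `x` is a
final window of `τ` and `c` is `τ` without its last entry. The sum over all of `[σ, x]` is `1` or
`0` according as `σ = x` or not, and the part below `c` is again an interval. -/
theorem UniqueWindow.sum_mu_notBelow {σ τ x c : Permutation} (hu : UniqueWindow σ τ)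
    (hk : 2 ≤ σ.len) {i a p q : ℕ} (hσ : OccursAt σ τ i a) (hx : OccursAt x τ p q)
    (hend : q + x.len = τ.len + 1) (hx0 : 1 ≤ x.len)
    (hc : OccursAt c τ 0 1) (hcl : c.len + 1 = τ.len) :
    ∑ ρ ∈ notBelow c σ x, IncidenceAlgebra.mu ℤ σ ρ =
      if i = p ∧ a = q then endSign σ τ a else 0 := by
  classical
  obtain ⟨x', hl, hx'⟩ := exists_occursAt τ (m := x.len - 1) hx.lt (by omega)
  have hsplit := Finset.sum_filter_add_sum_filter_not (Finset.Icc σ x) (fun ρ => ρ ≤ c)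
    (fun ρ => IncidenceAlgebra.mu ℤ σ ρ)
  have hbelow : (Finset.Icc σ x).filter (fun ρ => ρ ≤ c) = Finset.Icc σ x' := by
    ext ρ
    simp only [Finset.mem_filter, Finset.mem_Icc, and_assoc]
    exact and_congr_right fun h => hu.le_and_le_iff hk h hx hx' (by omega) hend hc hcl
  rw [hbelow, IncidenceAlgebra.sum_Icc_mu_right, IncidenceAlgebra.sum_Icc_mu_right] at hsplit
  rw [notBelow, eq_sub_of_add_eq' hsplit, endSign]
  simp only [hu.eq_iff hσ hx, hu.eq_iff hσ hx']
  split_ifs <;> first | rfl | omega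

/-- A proper pattern of `τ` is still a pattern after deleting the last, the first or the second
entry of `τ`. -/
theorem le_or_le_or_le_of_lt {ρ τ c₁ c₂ c : Permutation} (hρ : 2 ≤ ρ.len) (h : ρ < τ)
    (h₁ : OccursAt c₁ τ 1 2) (hl₁ : c₁.len + 1 = τ.len)
    (h₂ : OccursAt c₂ τ 0 2) (hl₂ : c₂.len + 1 = τ.len)
    (hc : OccursAt c τ 0 1) (hcl : c.len + 1 = τ.len) : ρ ≤ c ∨ ρ ≤ c₁ ∨ ρ ≤ c₂ := by
  obtain ⟨i, a, ho⟩ := exists_occursAt_of_le h.le hρ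
  have h1 := ho.lt
  have h2 := ho.end_le
  have h3 : ρ.len ≠ τ.len := fun e => h.ne (eq_of_le_of_len_eq h.le e)
  by_cases hend : a + ρ.len ≤ τ.len
  · exact Or.inl (ho.le_of_window_subset hc (by omega) (by omega) (by omega))
  · rcases Nat.eq_zero_or_pos i with hi | hi
    · exact Or.inr (Or.inr (ho.le_of_window_subset h₂ (by omega) (by omega) (by omega)))
    · by_cases ha : i = 1 ∨ 2 ≤ i
      · exact Or.inr (Or.inl (ho.le_of_window_subset h₁ (by omega) (by omega) (by omega)))
      · omega

/-- The meet of the two permutations obtained by deleting the first or the second entry of `τ`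
need not exist, but among the elements of `[σ, τ]` which reach the last entry of `τ`
it is obtained by deleting both. -/
theorem UniqueWindow.le_delete_first_two {σ τ ρ c₁ c₂ c d : Permutation} (hu : UniqueWindow σ τ)
    (hk : 2 ≤ σ.len) (hσρ : σ ≤ ρ) (hne : c₁ ≠ c₂)
    (h₁ : OccursAt c₁ τ 1 2) (hl₁ : c₁.len + 1 = τ.len)
    (h₂ : OccursAt c₂ τ 0 2) (hl₂ : c₂.len + 1 = τ.len)
    (hc : OccursAt c τ 0 1) (hcl : c.len + 1 = τ.len)
    (hd : OccursAt d τ 2 3) (hdl : d.len + 2 = τ.len) (hρc : ¬ ρ ≤ c) :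
    ρ ≤ c₁ ∧ ρ ≤ c₂ ↔ ρ ≤ d := by
  constructor
  · rintro ⟨hρ1, hρ2⟩
    have hρ := hk.trans (len_le_of_le hσρ)
    obtain ⟨i, a, h, ha, hi, he⟩ := exists_occursAt_of_le_of_occursAt hρ1 hρ h₁
    obtain ⟨i', a', h', ha', hi', he'⟩ := exists_occursAt_of_le_of_occursAt hρ2 hρ h₂
    obtain rfl := hu.eq_of_occursAt hk hσρ h h'
    have hend : a + ρ.len = τ.len + 1 := by
      by_contra hcon
      have := h.end_le
      exact hρc (h.le_of_window_subset hc (by omega) (by omega) (by omega))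
    by_contra hcon
    have hrep : ∀ p, 2 ≤ p → ¬ OccursAt ρ τ p a := fun p hp hpo => by
      have := hpo.lt
      exact hcon (hpo.le_of_window_subset hd (by omega) (by omega) (by omega))
    obtain rfl : i = 1 := by
      by_contra h0
      exact hrep i (by omega) h
    obtain rfl : i' = 0 := by
      by_contra h0
      exact hrep i' (by omega) h'
    exact hne ((OccursAt.delete_first_two h' h hend hrep h₁).eq_of_len_eq h₂ (by omega))
  · intro h
    exact ⟨h.trans (hd.le_of_window_subset h₁ (by omega) (by omega) (by omega)),
      h.trans (hd.le_of_window_subset h₂ (by omega) (by omega) (by omega))⟩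

/-! ### The Möbius function -/

open scoped Classical in
/-- The Möbius function in terms of the window `(i, a)` of the only occurrence of `σ`. -/
theorem UniqueWindow.mu_eq {σ τ c₁ c₂ : Permutation} (hu : UniqueWindow σ τ)
    (hk : 2 ≤ σ.len) {i a : ℕ} (hσ : OccursAt σ τ i a) (hlen : σ.len < τ.len)
    (h₁ : OccursAt c₁ τ 1 2) (hl₁ : c₁.len + 1 = τ.len)
    (h₂ : OccursAt c₂ τ 0 2) (hl₂ : c₂.len + 1 = τ.len) :
    IncidenceAlgebra.mu ℤ σ τ =
      if i = 0 ∧ a = 1 then endSign σ τ a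
      else if a = 2 then - endSign σ τ a
      else if i = 2 ∧ a = 3 ∧ c₁ ≠ c₂ then endSign σ τ a
      else 0 := by
  obtain ⟨c, hcl, hc⟩ := exists_occursAt τ (i := 0) (a := 1) (m := τ.len - 1) (by omega) (by omega)
  obtain ⟨d, hdl, hd⟩ := exists_occursAt τ (i := 2) (a := 3) (m := τ.len - 2) (by omega) (by omega)
  have hcl : c.len + 1 = τ.len := by omega
  have hia := hσ.lt
  have T := hu.sum_mu_notBelow hk hσ (OccursAt.refl τ) (by omega) (by omega) hc hcl
  have T₁ := hu.sum_mu_notBelow hk hσ h₁ (by omega) (by omega) hc hcl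
  have T₂ := hu.sum_mu_notBelow hk hσ h₂ (by omega) (by omega) hc hcl
  have Td := hu.sum_mu_notBelow hk hσ hd (by omega) (by omega) hc hcl
  have hc₁τ : c₁ < τ := lt_of_le_of_ne h₁.le fun e => by rw [e] at hl₁; omega
  have hc₂τ : c₂ < τ := lt_of_le_of_ne h₂.le fun e => by rw [e] at hl₂; omega
  have hFτ : notBelow c σ τ = insert τ (notBelow c σ c₁ ∪ notBelow c σ c₂) := by
    ext ρ
    simp only [mem_notBelow, Finset.mem_insert, Finset.mem_union]
    constructor
    · rintro ⟨h1, h2, h3⟩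
      rcases h2.eq_or_lt with h | h
      · exact Or.inl h
      · rcases le_or_le_or_le_of_lt (hk.trans (len_le_of_le h1)) h h₁ hl₁ h₂ hl₂ hc hcl
          with h4 | h4 | h4
        · exact absurd h4 h3
        · exact Or.inr (Or.inl ⟨h1, h4, h3⟩)
        · exact Or.inr (Or.inr ⟨h1, h4, h3⟩)
    · rintro (rfl | ⟨h1, h2, h3⟩ | ⟨h1, h2, h3⟩)
      · refine ⟨hσ.le, le_rfl, fun h => ?_⟩
        have := len_le_of_le h
        omega
      · exact ⟨h1, h2.trans hc₁τ.le, h3⟩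
      · exact ⟨h1, h2.trans hc₂τ.le, h3⟩
  have hτF : τ ∉ notBelow c σ c₁ ∪ notBelow c σ c₂ := by
    simp only [mem_notBelow, Finset.mem_union]
    rintro (⟨-, h, -⟩ | ⟨-, h, -⟩)
    · exact hc₁τ.not_ge h
    · exact hc₂τ.not_ge h
  rw [hFτ, Finset.sum_insert hτF] at T
  by_cases hcc : c₁ = c₂
  · subst hcc
    -- with `i = 0`, `a = 2` the equality would give a second occurrence of `σ` at the second entry
    have hi : ¬ (i = 0 ∧ a = 2) := by
      rintro ⟨rfl, rfl⟩
      have hle : σ ≤ c₁ :=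
        hσ.le_of_window_subset h₂ le_rfl (Or.inl rfl) (by have := hσ.end_le; omega)
      obtain ⟨i', a', h', -, hi', -⟩ := exists_occursAt_of_le_of_occursAt hle hk h₁
      have := (hu _ _ _ _ hσ h').1
      omega
    rw [Finset.union_self, T₁] at T
    rw [eq_sub_of_add_eq T]
    generalize endSign σ τ a = E
    split_ifs <;> first | omega | simp_all
  · have hFd : notBelow c σ c₁ ∩ notBelow c σ c₂ = notBelow c σ d := by
      ext ρ
      simp only [mem_notBelow, Finset.mem_inter]
      have key := fun (h1 : σ ≤ ρ) (h3 : ¬ ρ ≤ c) =>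
        hu.le_delete_first_two hk h1 hcc h₁ hl₁ h₂ hl₂ hc hcl hd (by omega) h3
      constructor
      · rintro ⟨⟨h1, h2, h3⟩, -, h4, -⟩
        exact ⟨h1, (key h1 h3).1 ⟨h2, h4⟩, h3⟩
      · rintro ⟨h1, h2, h3⟩
        have := (key h1 h3).2 h2
        exact ⟨⟨h1, this.1, h3⟩, h1, this.2, h3⟩
    have hsum := Finset.sum_union_inter (s₁ := notBelow c σ c₁) (s₂ := notBelow c σ c₂)
      (f := fun ρ => IncidenceAlgebra.mu ℤ σ ρ)
    rw [hFd, T₁, T₂, Td] at hsum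
    rw [eq_sub_of_add_eq T, eq_sub_of_add_eq hsum]
    generalize endSign σ τ a = E
    split_ifs <;> first | omega | simp_all

/-- From the empty permutation, the Möbius function vanishes from length two on: every nonempty
permutation is above the one of length one. -/
theorem mu_eq_zero_of_len_eq_zero {σ τ : Permutation} (hσ : σ.len = 0) (hτ : 2 ≤ τ.len) :
    IncidenceAlgebra.mu ℤ σ τ = 0 := by
  have hbot : ∀ ρ : Permutation, σ ≤ ρ := fun ρ => by
    obtain ⟨x, hx, hxo⟩ := exists_occursAt ρ (i := 0) (a := 1) (m := 0) (by omega) (by omega)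
    have hlex := hxo.le
    obtain ⟨m, s⟩ := σ
    obtain ⟨n, t⟩ := x
    simp only at hσ hx
    subst hσ hx
    rwa [Subsingleton.elim s t]
  -- `o` is the permutation of length one
  obtain ⟨o, hol, ho⟩ := exists_occursAt τ (i := 0) (a := 1) (m := 1) (by omega) (by omega)
  have hone : ∀ ρ : Permutation, ρ.len = 1 → ρ = o := fun ρ hρ => by
    obtain ⟨m, s⟩ := ρ
    obtain ⟨n, t⟩ := o
    simp only at hρ hol
    subst hρ hol
    rw [Subsingleton.elim s t]
  have hσo : σ ≠ o := fun e => by rw [e] at hσ; omega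
  have hmuo : IncidenceAlgebra.mu ℤ σ o = -1 := by
    rw [IncidenceAlgebra.mu_eq_neg_sum_Ico_of_ne hσo]
    have : Finset.Ico σ o = {σ} := by
      ext ρ
      simp only [Finset.mem_Ico, Finset.mem_singleton]
      constructor
      · rintro ⟨h1, h2⟩
        have h3 : ρ.len ≠ o.len := fun e => h2.ne (eq_of_le_of_len_eq h2.le e)
        have h4 := len_le_of_le h2.le
        exact (eq_of_le_of_len_eq h1 (by omega)).symm
      · rintro rfl
        exact ⟨le_rfl, lt_of_le_of_ne (hbot _) hσo⟩
    simp [this]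
  induction hn : τ.len using Nat.strong_induction_on generalizing τ with
  | _ n ih =>
    have hτo : τ.len ≠ o.len := by omega
    have hoτ : o ≤ τ := ho.le
    have hστ : σ ≠ τ := fun e => by rw [e] at hσ; omega
    rw [IncidenceAlgebra.mu_eq_neg_sum_Ico_of_ne hστ, neg_eq_zero,
      ← Finset.sum_subset (s₁ := {σ, o})]
    · simp [Finset.sum_pair hσo, hmuo]
    · intro ρ
      simp only [Finset.mem_insert, Finset.mem_singleton, Finset.mem_Ico]
      rintro (rfl | rfl)
      · exact ⟨le_rfl, lt_of_le_of_ne (hbot _) hστ⟩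
      · exact ⟨hbot _, lt_of_le_of_ne hoτ fun e => hτo (by rw [e])⟩
    · intro ρ hρ hρ'
      simp only [Finset.mem_insert, Finset.mem_singleton, Finset.mem_Ico, not_or] at hρ hρ'
      have h1 : ρ.len ≠ σ.len := fun e => hρ'.1 (eq_of_le_of_len_eq hρ.1 e.symm).symm
      have h2 : ρ.len ≠ 1 := fun e => hρ'.2 (hone ρ e)
      have h3 : ρ.len ≠ τ.len := fun e => hρ.2.ne (eq_of_le_of_len_eq hρ.2.le e)
      have h4 := len_le_of_le hρ.2.le
      obtain ⟨x, hx, hxo⟩ :=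
        exists_occursAt ρ (i := 0) (a := 1) (m := 1) (by omega) (by omega)
      rw [hone x hx] at hxo
      exact ih ρ.len (by omega) (by omega) hxo rfl

/-! ### Rank and covering relation -/

theorem exists_ltSeries {σ τ : Permutation} (h : σ ≤ τ) :
    ∃ l : LTSeries Permutation, l.head = σ ∧ l.last = τ ∧ l.length = τ.len - σ.len := by
  induction hd : τ.len - σ.len generalizing τ with
  | zero =>
    obtain rfl := eq_of_le_of_len_eq h (le_antisymm (len_le_of_le h) (by omega))
    exact ⟨RelSeries.singleton _ σ, rfl, rfl, rfl⟩
  | succ d ih =>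
    obtain ⟨ρ, hρ, h1, h2⟩ := exists_intermediate h (by omega)
    obtain ⟨l, hl1, hl2, hl3⟩ := ih h1 (by omega)
    have hlt : l.last < τ := lt_of_le_of_ne (hl2 ▸ h2) fun e => by
      rw [hl2] at e; rw [e] at hρ; omega
    refine ⟨l.snoc τ hlt, by simpa using hl1, by simp, by simp [hl3]⟩

theorem intervalRank_eq {σ τ : Permutation} (h : σ ≤ τ) :
    intervalRank σ τ = ((τ.len - σ.len : ℕ) : WithBot ℕ∞) := by
  apply le_antisymm
  · refine iSup_le fun p => ?_
    have key : ∀ m (hm : m < p.length + 1), σ.len + m ≤ (p ⟨m, hm⟩).1.len := by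
      intro m
      induction m with
      | zero => intro hm; simpa using len_le_of_le (p ⟨0, hm⟩).2.1
      | succ m ih =>
        intro hm
        have h1 := ih (by omega)
        have h2 : (p ⟨m, by omega⟩).1 < (p ⟨m + 1, hm⟩).1 :=
          p.strictMono (by simp [Fin.lt_def])
        have h3 := len_le_of_le h2.le
        have h4 : (p ⟨m, by omega⟩).1.len ≠ (p ⟨m + 1, hm⟩).1.len := fun e =>
          h2.ne (eq_of_le_of_len_eq h2.le e)
        omega
    have h1 := key p.length (by omega)
    have h2 := len_le_of_le (p ⟨p.length, by omega⟩).2.2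
    exact_mod_cast (by omega : p.length ≤ τ.len - σ.len)
  · obtain ⟨l, hl1, hl2, hl3⟩ := exists_ltSeries h
    let l' : LTSeries (Set.Icc σ τ) := LTSeries.mk l.length
      (fun i => ⟨l i, hl1 ▸ l.monotone (Fin.zero_le i), hl2 ▸ l.monotone (Fin.le_last i)⟩)
      (fun i j hij => l.strictMono hij)
    have := Order.LTSeries.length_le_krullDim l'
    rw [← hl3]
    exact this

theorem covBy_iff_len {σ τ : Permutation} (h : σ ≤ τ) : σ ⋖ τ ↔ σ.len + 1 = τ.len := by
  constructor
  · intro hc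
    have h1 : σ.len ≠ τ.len := fun e => hc.ne (eq_of_le_of_len_eq h e)
    have h2 := len_le_of_le h
    obtain ⟨ρ, hρ, h3, h4⟩ := exists_intermediate h (by omega)
    rcases hc.eq_or_eq h3 h4 with rfl | rfl <;> omega
  · intro hl
    refine ⟨lt_of_le_of_ne h fun e => by rw [e] at hl; omega, fun ρ h1 h2 => ?_⟩
    have h3 := len_le_of_le h1.le
    have h4 := len_le_of_le h2.le
    have h5 : σ.len ≠ ρ.len := fun e => h1.ne (eq_of_le_of_len_eq h1.le e)
    have h6 : ρ.len ≠ τ.len := fun e => h2.ne (eq_of_le_of_len_eq h2.le e)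
    omega

theorem ncard_coatoms_eq_three_iff {σ τ c₁ c₂ : Permutation} (hk : 2 ≤ σ.len)
    (hσ : OccursAt σ τ 2 3) (hl : σ.len + 3 = τ.len)
    (h₁ : OccursAt c₁ τ 1 2) (hl₁ : c₁.len + 1 = τ.len)
    (h₂ : OccursAt c₂ τ 0 2) (hl₂ : c₂.len + 1 = τ.len) (hu : UniqueWindow σ τ) :
    {ρ : Permutation | ρ ∈ Set.Icc σ τ ∧ ρ ⋖ τ}.ncard = 3 ↔ c₁ ≠ c₂ := by
  obtain ⟨c, hcl, hc⟩ := exists_occursAt τ (i := 0) (a := 1) (m := τ.len - 1) (by omega) (by omega)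
  have s₁ : σ ≤ c₁ := hσ.le_of_window_subset h₁ (by omega) (by omega) (by omega)
  have s₂ : σ ≤ c₂ := hσ.le_of_window_subset h₂ (by omega) (by omega) (by omega)
  have s : σ ≤ c := hσ.le_of_window_subset hc (by omega) (by omega) (by omega)
  have hset : {ρ : Permutation | ρ ∈ Set.Icc σ τ ∧ ρ ⋖ τ} = {c, c₁, c₂} := by
    ext ρ
    simp only [Set.mem_ofPred_eq, Set.mem_Icc, Set.mem_insert_iff, Set.mem_singleton_iff]
    constructor
    · rintro ⟨⟨h1, h2⟩, h3⟩
      have hρ := (covBy_iff_len h2).1 h3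
      rcases le_or_le_or_le_of_lt (hk.trans (len_le_of_le h1)) h3.lt h₁ hl₁ h₂ hl₂ hc (by omega)
        with h | h | h
      · exact Or.inl (eq_of_le_of_len_eq h (by omega))
      · exact Or.inr (Or.inl (eq_of_le_of_len_eq h (by omega)))
      · exact Or.inr (Or.inr (eq_of_le_of_len_eq h (by omega)))
    · rintro (rfl | rfl | rfl)
      · exact ⟨⟨s, hc.le⟩, (covBy_iff_len hc.le).2 (by omega)⟩
      · exact ⟨⟨s₁, h₁.le⟩, (covBy_iff_len h₁.le).2 (by omega)⟩
      · exact ⟨⟨s₂, h₂.le⟩, (covBy_iff_len h₂.le).2 (by omega)⟩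
  have n₁ : c ≠ c₁ := by
    rintro rfl
    exact absurd (hu.eq_of_occursAt hk s hc h₁) (by omega)
  have n₂ : c ≠ c₂ := by
    rintro rfl
    exact absurd (hu.eq_of_occursAt hk s hc h₂) (by omega)
  rw [hset]
  constructor
  · rintro h rfl
    rw [Set.pair_eq_singleton, Set.ncard_pair n₁] at h
    omega
  · intro h
    exact Set.ncard_eq_three.2 ⟨c, c₁, c₂, n₁, n₂, h, rfl⟩

/-! ### Reading the window off an occurrence -/

theorem involves_iff {σ τ : Permutation} {f : Fin σ.len ↪o Fin τ.len} {i a : ℕ}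
    (hk : 2 ≤ σ.len) (hfpos : ∀ j, (f j : ℕ) = windowPos i a j) (p : ℕ) :
    Involves f p ↔ i + 1 = p ∨ (a + 1 ≤ p ∧ p + 1 ≤ a + σ.len) := by
  constructor
  · rintro ⟨j, hj⟩
    have := j.2
    rw [hfpos] at hj
    unfold windowPos at hj
    split_ifs at hj <;> omega
  · rintro (h | ⟨h1, h2⟩)
    · exact ⟨⟨0, by omega⟩, by rw [hfpos]; simpa [windowPos] using h⟩
    · exact ⟨⟨p - a, by omega⟩, by rw [hfpos]; unfold windowPos; split_ifs <;> simp_all <;> omega⟩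

theorem isConsecutive_iff {σ τ : Permutation} {f : Fin σ.len ↪o Fin τ.len} {i a : ℕ}
    (hk : 2 ≤ σ.len) (hfpos : ∀ j, (f j : ℕ) = windowPos i a j) :
    IsConsecutive f ↔ a = i + 1 := by
  constructor
  · intro h
    have := h ⟨0, by omega⟩ ⟨1, by omega⟩ rfl
    rw [hfpos, hfpos] at this
    simpa [windowPos] using this
  · intro h j k hjk
    rw [hfpos, hfpos]
    unfold windowPos
    split_ifs <;> omega

end QuasiConsecutive

/-! ### The Möbius function of an interval with a unique occurrence -/

theorem mainTheorem1 (σ τ : Permutation) (f : Fin σ.len ↪o Fin τ.len)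
    (hf : IsOccurrence σ τ f)
    (hunique : ∀ g : Fin σ.len ↪o Fin τ.len, IsOccurrence σ τ g → g = f) :
    (σ = τ → IncidenceAlgebra.mu ℤ σ τ = 1) ∧
    (σ ⋖ τ → IncidenceAlgebra.mu ℤ σ τ = -1) ∧
    (intervalRank σ τ = 2 ∧ Involves f 1 ∧ ¬ Involves f 2 ∧ ¬ Involves f τ.len →
      IncidenceAlgebra.mu ℤ σ τ = 1) ∧
    (intervalRank σ τ = 2 ∧ Involves f 2 ∧ ¬ Involves f 1 ∧ ¬ Involves f τ.len →
      IncidenceAlgebra.mu ℤ σ τ = 1) ∧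
    (intervalRank σ τ = 2 ∧ Involves f τ.len ∧ ¬ Involves f 1 ∧ ¬ Involves f 2 ∧
        ¬ FirstTwoConsecutive τ →
      IncidenceAlgebra.mu ℤ σ τ = 1) ∧
    (intervalRank σ τ = 3 ∧ Involves f (τ.len - 1) ∧ ¬ Involves f 1 ∧ ¬ Involves f 2 ∧
        ¬ Involves f τ.len ∧ IsConsecutive f ∧
        {ρ : Permutation | ρ ∈ Set.Icc σ τ ∧ ρ ⋖ τ}.ncard = 3 →
      IncidenceAlgebra.mu ℤ σ τ = -1) ∧
    (¬ (σ = τ) ∧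
      ¬ (σ ⋖ τ) ∧
      ¬ (intervalRank σ τ = 2 ∧ Involves f 1 ∧ ¬ Involves f 2 ∧ ¬ Involves f τ.len) ∧
      ¬ (intervalRank σ τ = 2 ∧ Involves f 2 ∧ ¬ Involves f 1 ∧ ¬ Involves f τ.len) ∧
      ¬ (intervalRank σ τ = 2 ∧ Involves f τ.len ∧ ¬ Involves f 1 ∧ ¬ Involves f 2 ∧
          ¬ FirstTwoConsecutive τ) ∧
      ¬ (intervalRank σ τ = 3 ∧ Involves f (τ.len - 1) ∧ ¬ Involves f 1 ∧ ¬ Involves f 2 ∧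
          ¬ Involves f τ.len ∧ IsConsecutive f ∧
          {ρ : Permutation | ρ ∈ Set.Icc σ τ ∧ ρ ⋖ τ}.ncard = 3) →
      IncidenceAlgebra.mu ℤ σ τ = 0) := by
  have hle : σ ≤ τ := ⟨f, hf⟩
  have hlen := len_le_of_le hle
  have heq : σ = τ ↔ σ.len = τ.len := ⟨fun h => by rw [← h], eq_of_le_of_len_eq hle⟩
  have hrank : ∀ r : ℕ, intervalRank σ τ = r ↔ τ.len - σ.len = r := fun r => by
    rw [intervalRank_eq hle]; exact_mod_cast Iff.rfl
  have hrank2 : intervalRank σ τ = 2 ↔ τ.len - σ.len = 2 := hrank 2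
  have hrank3 : intervalRank σ τ = 3 ↔ τ.len - σ.len = 3 := hrank 3
  have hself : σ = τ → IncidenceAlgebra.mu ℤ σ τ = 1 := by
    rintro rfl; exact IncidenceAlgebra.mu_self _
  have hcov : σ ⋖ τ → IncidenceAlgebra.mu ℤ σ τ = -1 := fun h => by
    rw [IncidenceAlgebra.mu_eq_neg_sum_Ico_of_ne h.ne]
    have : Finset.Ico σ τ = {σ} := by
      rw [← Finset.coe_inj, Finset.coe_Ico, h.Ico_eq, Finset.coe_singleton]
    simp [this]
  refine ⟨hself, hcov, ?_⟩
  rw [covBy_iff_len hle, heq, hrank2, hrank3]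
  by_cases hk0 : σ.len = 0
  · have hinv : ∀ p, ¬ Involves f p := fun p ⟨j, _⟩ => absurd j.2 (by omega)
    refine ⟨fun h => absurd h.2.1 (hinv _), fun h => absurd h.2.1 (hinv _),
      fun h => absurd h.2.1 (hinv _), fun h => absurd h.2.1 (hinv _),
      fun h => mu_eq_zero_of_len_eq_zero hk0 (by omega)⟩
  by_cases hk1 : σ.len = 1
  · -- the single entry of `σ` occurs at every position of `τ`, so `τ` has length one
    have hτ : τ.len = 1 := by
      by_contra hcon
      have hocc : ∀ p, p < τ.len → ∀ j, (f j : ℕ) = p := fun p hp j => by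
        obtain ⟨x, hx, hxo⟩ :=
          exists_occursAt τ (i := p) (a := p + 1) (m := 0) (by omega) (by omega)
        have hσo : OccursAt σ τ p (p + 1) := ⟨by omega, by omega, fun j k hj hk => by
          rw [show j = k by omega]; simp⟩
        obtain ⟨g, hg, hgp⟩ := hσo.exists_isOccurrence
        rw [← hunique g hg, hgp, show (j : ℕ) = 0 by omega]
        rfl
      have h0 := hocc 0 (by omega) ⟨0, by omega⟩
      have h1 := hocc 1 (by omega) ⟨0, by omega⟩
      omega
    refine ⟨fun h => ?_, fun h => ?_, fun h => ?_, fun h => ?_, fun h => ?_⟩ <;> omega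
  have hk : 2 ≤ σ.len := by omega
  obtain ⟨i, a, hσ, hfpos⟩ := exists_occursAt_of_isOccurrence hf hk
  have hu : UniqueWindow σ τ := by
    have key : ∀ i' a', OccursAt σ τ i' a' → i' = i ∧ a' = a := fun i' a' h => by
      obtain ⟨g, hg, hgp⟩ := h.exists_isOccurrence
      obtain rfl := hunique g hg
      have h0 := (hgp ⟨0, by omega⟩).symm.trans (hfpos ⟨0, by omega⟩)
      have h1 := (hgp ⟨1, by omega⟩).symm.trans (hfpos ⟨1, by omega⟩)
      exact ⟨by simpa [windowPos] using h0, by simpa [windowPos] using h1⟩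
    intro p q p' q' h h'
    obtain ⟨rfl, rfl⟩ := key _ _ h
    obtain ⟨rfl, rfl⟩ := key _ _ h'
    exact ⟨rfl, rfl⟩
  rcases hlen.eq_or_lt with hlen | hlen
  · refine ⟨fun h => ?_, fun h => ?_, fun h => ?_, fun h => ?_, fun h => ?_⟩ <;> omega
  obtain ⟨c₁, hl₁, h₁⟩ :=
    exists_occursAt τ (i := 1) (a := 2) (m := τ.len - 1) (by omega) (by omega)
  obtain ⟨c₂, hl₂, h₂⟩ :=
    exists_occursAt τ (i := 0) (a := 2) (m := τ.len - 1) (by omega) (by omega)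
  have hmu := hu.mu_eq hk hσ hlen h₁ (by omega) h₂ (by omega)
  have hfirst := delete_first_eq_delete_second_iff h₁ h₂ (by omega) (by omega) (by omega)
  have hcard := fun (h : i = 2) (h' : a = 3) (h'' : σ.len + 3 = τ.len) =>
    ncard_coatoms_eq_three_iff hk (by rw [h, h'] at hσ; exact hσ) h'' h₁ (by omega) h₂ (by omega) hu
  have hlt := hσ.lt
  have hend := hσ.end_le
  simp only [involves_iff hk hfpos, isConsecutive_iff hk hfpos, ← hfirst]
  rw [hmu, endSign]
  refine ⟨fun h => ?_, fun h => ?_, fun h => ?_, fun h => ?_, fun h => ?_⟩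
  · rw [if_neg (by omega), if_pos (by omega), if_neg (by omega), if_pos (by omega)]
    rfl
  · rw [if_neg (by omega), if_pos (by omega), if_neg (by omega), if_pos (by omega)]
    rfl
  · rw [if_neg (by omega), if_neg (by omega), if_pos ⟨by omega, by omega, h.2.2.2.2⟩,
      if_pos (by omega)]
  · have hc : c₁ ≠ c₂ := (hcard (by omega) (by omega) (by omega)).1 h.2.2.2.2.2.2
    rw [if_neg (by omega), if_neg (by omega), if_pos ⟨by omega, by omega, hc⟩,
      if_neg (by omega), if_pos (by omega)]
  · obtain ⟨-, hn1, hn2, hn3, hn4, hn5⟩ := h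
    by_cases hd : i = 2 ∧ a = 3 ∧ c₁ ≠ c₂
    · obtain ⟨hi, ha, hc⟩ := hd
      have g4 : ¬ a + σ.len = τ.len + 1 := fun e =>
        hn4 ⟨by omega, by omega, by omega, by omega, hc⟩
      have g5 : ¬ a + σ.len = τ.len := fun e =>
        hn5 ⟨by omega, by omega, by omega, by omega, by omega, by omega,
          (hcard hi ha (by omega)).2 hc⟩
      rw [if_neg (by omega), if_neg (by omega), if_pos ⟨hi, ha, hc⟩, if_neg g4, if_neg g5]
    · rw [if_neg hd]
      clear hn4 hn5 hd
      split_ifs <;> first | rfl | omega
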